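/- A two-party XOR game is given by finite question sets $X$ (Alice) and $Y$ (Bob), a probability distribution $p(x,y)$ on $X\times Y$ and a function $f:X\times Y\to\{0,1\}$. On receiving $x$ and $y$ the players, who do not communicate, answer with bits $a$ and $b$, and they win iff $a\oplus b=f(x,y)$. The game matrix is $\Phi_{xy}=(-1)^{f(x,y)}p(x,y)$. For a box $P(a,b|x,y)$ let $\omega(P)=\sum_{x,y}p(x,y)\sum_{a\oplus b=f(x,y)}P(a,b|x,y)$. The classical value $\omega_c$ is the supremum of $\omega(P)$ over local (hidden-variable) boxes $P$. The quantum value $\omega_q$ is the supremum of $\omega(P)$ over boxes $P(a,b|x,y)=\langle\psi|M_x^a\otimes N_y^b|\psi\rangle$ with a unit vector $|\psi\rangle\in\mathcal H_A\otimes\mathcal H_B$ and projective measurements $\{M_x^a\}_a$ on $\mathcal H_A$ and $\{N_y^b\}_b$ on $\mathcal H_B$, for arbitrary complex Hilbert spaces $\mathcal H_A,\mathcal H_B$. There is no quantum advantage if $\omega_q=\omega_c$. **Theorem.** Consider a two-party XOR game whose game matrix $\Phi$ has no all-zero row and no all-zero column. Let $S_c=|s^A\rangle\langle s^B|$ be the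 strategy matrix of an optimal classical deterministic strategy: $s^A_x=(-1)^{\alpha(x)}$ and $s^B_y=(-1)^{\beta(y)}$, where the deterministic answers $a=\alpha(x)$, $b=\beta(y)$ attain $\omega_c$. Let $$\Sigma=\mathrm{Diag}\big(\{\langle i|\Phi|s^B\rangle\langle s^A|i\rangle\}_{i\in X}\big),\qquad \Lambda=\mathrm{Diag}\big(\{\langle i|s^B\rangle\langle s^A|\Phi|i\rangle\}_{i\in Y}\big).$$ There is no quantum advantage for $\Phi$ if and only if $\Sigma$ and $\Lambda$ are positive definite and $$\rho(\Lambda^{-1}\Phi^{T}\Sigma^{-1}\Phi)=1,$$ where $\rho$ denotes the spectral radius, the largest modulus of a (complex) eigenvalue. -/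

import Mathlib

open scoped TensorProduct Matrix

noncomputable section

/-- A box `P a b x y = P(a, b | x, y)` with question sets `X`, `Y` and one output bit per player. -/
abbrev Box (X Y : Type*) := Bool → Bool → X → Y → ℝ

/-- The sign `(-1) ^ b` of a bit. -/
def bitSign (b : Bool) : ℝ := if b then -1 else 1

/-- Local boxes: `P(a, b | x, y) = ∫ p(a | x, l) p(b | y, l) dq(l)` for a hidden variable `l`
distributed according to a probability measure `q` that does not depend on the questions. -/
def Box.IsLocal {X Y : Type*} (P : Box X Y) : Prop :=
  ∃ (L : Type) (_ : MeasurableSpace L) (q : MeasureTheory.Measure L)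
    (pA : L → Bool → X → ℝ) (pB : L → Bool → Y → ℝ),
    MeasureTheory.IsProbabilityMeasure q ∧
    (∀ a x, Measurable fun l => pA l a x) ∧ (∀ b y, Measurable fun l => pB l b y) ∧
    (∀ l a x, 0 ≤ pA l a x) ∧ (∀ l b y, 0 ≤ pB l b y) ∧
    (∀ l x, ∑ a, pA l a x = 1) ∧ (∀ l y, ∑ b, pB l b y = 1) ∧
    ∀ a b x y, P a b x y = ∫ l, pA l a x * pB l b y ∂q

/-- The deterministic local box in which Alice answers `α x` and Bob answers `β y`. -/
def Box.deterministic {X Y : Type*} (α : X → Bool) (β : Y → Bool) : Box X Y :=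
  fun a b x y => if α x = a ∧ β y = b then 1 else 0

/-- A projective measurement with outcomes in `ι` on a Hilbert space `H`. -/
structure ProjectiveMeasurement (ι : Type*) [Fintype ι] (H : Type*) [NormedAddCommGroup H]
    [InnerProductSpace ℂ H] [CompleteSpace H] where
  proj : ι → H →L[ℂ] H
  isStarProjection : ∀ i, IsStarProjection (proj i)
  orthogonal : ∀ i j, i ≠ j → proj i * proj j = 0
  sum_eq_one : ∑ i, proj i = 1

/-- The Hilbert space tensor product: the completion of the algebraic tensor product. -/
abbrev HilbertTensor (H K : Type*) [NormedAddCommGroup H] [InnerProductSpace ℂ H]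
    [NormedAddCommGroup K] [InnerProductSpace ℂ K] :=
  UniformSpace.Completion (H ⊗[ℂ] K)

/-- The operator `S ⊗ T` on the Hilbert space tensor product. -/
def HilbertTensor.map {H K : Type*} [NormedAddCommGroup H] [InnerProductSpace ℂ H]
    [NormedAddCommGroup K] [InnerProductSpace ℂ K] (S : H →L[ℂ] H) (T : K →L[ℂ] K) :
    HilbertTensor H K →L[ℂ] HilbertTensor H K :=
  (TensorProduct.mapL S T).completion

/-- Quantum boxes: `P(a, b | x, y) = ⟨ψ| M_x^a ⊗ N_y^b |ψ⟩` for a unit vector `ψ` in the tensor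
product of two arbitrary Hilbert spaces and projective measurements `M_x` and `N_y` on the two
tensor factors. -/
def Box.IsQuantum {X Y : Type*} (P : Box X Y) : Prop :=
  ∃ (HA HB : Type) (_ : NormedAddCommGroup HA) (_ : InnerProductSpace ℂ HA) (_ : CompleteSpace HA)
    (_ : NormedAddCommGroup HB) (_ : InnerProductSpace ℂ HB) (_ : CompleteSpace HB)
    (ψ : HilbertTensor HA HB) (M : X → ProjectiveMeasurement Bool HA)
    (N : Y → ProjectiveMeasurement Bool HB),
    ‖ψ‖ = 1 ∧
    ∀ a b x y,
      (P a b x y : ℂ) = inner ℂ ψ (HilbertTensor.map ((M x).proj a) ((N y).proj b) ψ)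

/-- A two-party XOR game: the referee draws the questions `(x, y)` with probability `p x y`, and
answers `a`, `b` win iff `a ⊕ b = f x y`. -/
structure XORGame (X Y : Type*) [Fintype X] [Fintype Y] where
  p : X → Y → ℝ
  p_nonneg : ∀ x y, 0 ≤ p x y
  p_sum : ∑ x, ∑ y, p x y = 1
  f : X → Y → Bool

namespace XORGame

variable {X Y : Type*} [Fintype X] [Fintype Y]

/-- The payoff function `V(a, b | x, y)`. -/
def payoff (g : XORGame X Y) (a b : Bool) (x : X) (y : Y) : ℝ :=
  if xor a b = g.f x y then 1 else 0

/-- The average probability of success `ω` of the strategy described by the box `P`. -/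
def winProb (g : XORGame X Y) (P : Box X Y) : ℝ :=
  ∑ x, ∑ y, ∑ a, ∑ b, g.p x y * g.payoff a b x y * P a b x y

/-- The classical value `ω_c`. -/
def classicalValue (g : XORGame X Y) : ℝ :=
  sSup {w | ∃ P : Box X Y, P.IsLocal ∧ g.winProb P = w}

/-- The quantum value `ω_q`. -/
def quantumValue (g : XORGame X Y) : ℝ :=
  sSup {w | ∃ P : Box X Y, P.IsQuantum ∧ g.winProb P = w}

/-- There is no quantum advantage: `ω_q = ω_c`. -/
def NoQuantumAdvantage (g : XORGame X Y) : Prop :=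
  g.quantumValue = g.classicalValue

/-- The deterministic strategy with answers `α`, `β` is an optimal classical strategy. Its strategy
matrix is `|s^A⟩⟨s^B|` with `s^A_x = (-1) ^ α x` and `s^B_y = (-1) ^ β y`. -/
def IsOptimalClassical (g : XORGame X Y) (α : X → Bool) (β : Y → Bool) : Prop :=
  g.winProb (Box.deterministic α β) = g.classicalValue

/-- The game matrix `Φ`. -/
def gameMatrix (g : XORGame X Y) : Matrix X Y ℝ :=
  Matrix.of fun x y => bitSign (g.f x y) * g.p x y

end XORGame

/-- `Σ = Diag(⟨i|Φ|s^B⟩⟨s^A|i⟩)`. -/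
def sigmaMatrix {X Y : Type*} [Fintype Y] [DecidableEq X]
    (Φ : Matrix X Y ℝ) (sA : X → ℝ) (sB : Y → ℝ) : Matrix X X ℝ :=
  Matrix.diagonal fun i => (Φ *ᵥ sB) i * sA i

/-- `Λ = Diag(⟨i|s^B⟩⟨s^A|Φ|i⟩)`. -/
def lambdaMatrix {X Y : Type*} [Fintype X] [DecidableEq Y]
    (Φ : Matrix X Y ℝ) (sA : X → ℝ) (sB : Y → ℝ) : Matrix Y Y ℝ :=
  Matrix.diagonal fun i => sB i * (sA ᵥ* Φ) i

/-- The spectral radius of a real matrix: the largest modulus of its complex eigenvalues. -/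
def realSpectralRadius {n : Type*} [Fintype n] [DecidableEq n] (M : Matrix n n ℝ) : ENNReal :=
  spectralRadius ℂ (M.map Complex.ofReal)

end

noncomputable section

/-! Everything is controlled by the block form `B = [[Σ, -Φ], [-Φᵀ, Λ]]`. When `Σ` and `Λ` are
positive definite, a Schur complement shows that `B` is positive semidefinite iff `ρ(Λ⁻¹ Φᵀ Σ⁻¹ Φ) ≤
1`. Since `Λ⁻¹ Φᵀ Σ⁻¹ Φ` always fixes `s^B`, the bound is then an equality.

If `B` is positive semidefinite, it is a dual certificate: quantum correlators are real inner
products of unit vectors (`Box.IsQuantum.exists_unit_vectors`), and evaluating `B` on them bounds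
the quantum bias by `(tr Σ + tr Λ) / 2`, which is the bias of the given classical strategy
(`sum_mul_re_inner_le_of_realSpectralRadius_le_one`).

Conversely, measuring a maximally entangled pair of qubits realises all correlators `cos (θ x - φ
y)`, and angles in `{0, π}` reproduce the classical strategy. Without a quantum advantage this point
is a maximum, and its second order condition is exactly that `B` is nonnegative
(`IsOptimalClassical.two_mul_sum_le_of_noQuantumAdvantage`). Nonzero rows and columns then force `Σ`
and `Λ` to be positive. -/

lemma mem_spectrum_iff_exists_mulVec_eq_smul {n : Type*} [Fintype n] [DecidableEq n]
    (M : Matrix n n ℂ) (μ : ℂ) :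
    μ ∈ spectrum ℂ M ↔ ∃ v : n → ℂ, v ≠ 0 ∧ M *ᵥ v = μ • v := by
  rw [← Matrix.spectrum_toLin', ← Module.End.hasEigenvalue_iff_mem_spectrum]
  constructor
  · intro h
    obtain ⟨v, hv⟩ := h.exists_hasEigenvector
    exact ⟨v, hv.2, by simpa using hv.apply_eq_smul⟩
  · rintro ⟨v, h0, hv⟩
    exact Module.End.hasEigenvalue_of_hasEigenvector
      (x := v) ⟨Module.End.mem_eigenspace_iff.2 (by simpa using hv), h0⟩

lemma realSpectralRadius_le_one_iff {n : Type*} [Fintype n] [DecidableEq n]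
    (M : Matrix n n ℝ) :
    realSpectralRadius M ≤ 1 ↔
      ∀ (μ : ℂ) (v : n → ℂ), v ≠ 0 → M.map Complex.ofReal *ᵥ v = μ • v → ‖μ‖ ≤ 1 := by
  simp only [realSpectralRadius, spectralRadius, iSup_le_iff,
    mem_spectrum_iff_exists_mulVec_eq_smul]
  constructor
  · intro h μ v h0 hv
    have := h μ ⟨v, h0, hv⟩
    exact_mod_cast this
  · rintro h μ ⟨v, h0, hv⟩
    have := h μ v h0 hv
    exact_mod_cast this

lemma map_ofReal_mulVec {m n : Type*} [Fintype n] (M : Matrix m n ℝ) (v : n → ℝ) :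
    M.map Complex.ofReal *ᵥ (fun i => (v i : ℂ)) = fun i => ((M *ᵥ v) i : ℂ) := by
  ext i
  simp [Matrix.mulVec, dotProduct]

lemma abs_le_one_of_realSpectralRadius_le_one {n : Type*} [Fintype n] [DecidableEq n]
    {M : Matrix n n ℝ} (h : realSpectralRadius M ≤ 1) {μ : ℝ} {v : n → ℝ} (h0 : v ≠ 0)
    (hv : M *ᵥ v = μ • v) : |μ| ≤ 1 := by
  have := (realSpectralRadius_le_one_iff M).1 h μ (fun i => (v i : ℂ)) (fun h' => h0 (by
    ext i; simpa using congrFun h' i)) (by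
    rw [map_ofReal_mulVec, hv]; ext i; simp)
  simpa using this

lemma one_le_realSpectralRadius {n : Type*} [Fintype n] [DecidableEq n]
    {M : Matrix n n ℝ} {v : n → ℝ} (h0 : v ≠ 0) (hv : M *ᵥ v = v) :
    1 ≤ realSpectralRadius M := by
  have hmem : (1 : ℂ) ∈ spectrum ℂ (M.map Complex.ofReal) :=
    (mem_spectrum_iff_exists_mulVec_eq_smul _ _).2 ⟨fun i => (v i : ℂ), fun h' => h0 (by
      ext i; simpa using congrFun h' i), by rw [map_ofReal_mulVec, hv]; simp⟩
  have := le_iSup₂ (f := fun (k : ℂ) (_ : k ∈ spectrum ℂ (M.map Complex.ofReal)) =>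
    (‖k‖₊ : ENNReal)) 1 hmem
  rw [nnnorm_one, ENNReal.coe_one] at this
  exact this

/-! ### Spectral radius bounds and the block quadratic form -/

section Blocks

variable {X Y : Type*} [Fintype X] [Fintype Y] [DecidableEq X] [DecidableEq Y]

lemma inv_diagonal_of_pos {s : X → ℝ} (hs : ∀ x, 0 < s x) :
    (Matrix.diagonal s)⁻¹ = Matrix.diagonal fun x => (s x)⁻¹ := by
  apply Matrix.inv_eq_left_inv
  rw [Matrix.diagonal_mul_diagonal, ← Matrix.diagonal_one]
  congr 1
  ext x
  exact inv_mul_cancel₀ (hs x).ne'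

/-- With `T = diagonal t`, the matrix `T⁻¹ K` is similar to the symmetric matrix `T^(-1/2) K
T^(-1/2)`, whose real eigenvalues are therefore at most 1. Conjugating by `T^(1/2)` gives the claim.
-/
lemma posSemidef_sub_of_realSpectralRadius_le_one (K : Matrix Y Y ℝ) (hK : K.IsHermitian)
    {t : Y → ℝ} (ht : ∀ y, 0 < t y)
    (h : realSpectralRadius ((Matrix.diagonal t)⁻¹ * K) ≤ 1) :
    (Matrix.diagonal t - K).PosSemidef := by
  set E : Matrix Y Y ℝ := Matrix.diagonal fun y => √(t y) with hE
  set D : Matrix Y Y ℝ := Matrix.diagonal fun y => (√(t y))⁻¹ with hD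
  have hsq : ∀ y, √(t y) ≠ 0 := fun y => (Real.sqrt_pos.2 (ht y)).ne'
  have hED : E * D = 1 := by
    rw [hE, hD, Matrix.diagonal_mul_diagonal, ← Matrix.diagonal_one]
    congr 1; ext y; exact mul_inv_cancel₀ (hsq y)
  have hDE : D * E = 1 := mul_eq_one_comm.1 hED
  have hEE : E * E = Matrix.diagonal t := by
    rw [hE, Matrix.diagonal_mul_diagonal]
    congr 1; ext y; exact Real.mul_self_sqrt (ht y).le
  have hDD : D * D = (Matrix.diagonal t)⁻¹ := by
    rw [inv_diagonal_of_pos ht, hD, Matrix.diagonal_mul_diagonal]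
    congr 1; ext y; rw [← mul_inv, Real.mul_self_sqrt (ht y).le]
  have hEt : Eᴴ = E := by rw [hE]; simp
  have hDt : Dᴴ = D := by rw [hD]; simp
  have hN : (1 - D * K * D).IsHermitian := by
    refine Matrix.isHermitian_one.sub ?_
    rw [Matrix.IsHermitian, Matrix.conjTranspose_mul, Matrix.conjTranspose_mul, hDt, hK.eq,
      Matrix.mul_assoc]
  have hpsd : (1 - D * K * D).PosSemidef := by
    rw [hN.posSemidef_iff_eigenvalues_nonneg]
    intro i
    have hv := hN.mulVec_eigenvectorBasis i
    set μ := hN.eigenvalues i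
    set v : Y → ℝ := ⇑(hN.eigenvectorBasis i) with hvdef
    have hv0 : v ≠ 0 := by
      intro h0
      apply (hN.eigenvectorBasis.toBasis.ne_zero i)
      ext y
      simpa using congrFun h0 y
    have hv1 : (D * K * D) *ᵥ v = (1 - μ) • v := by
      rw [Matrix.sub_mulVec, Matrix.one_mulVec] at hv
      rw [sub_smul, one_smul, ← hv]; simp
    -- The similarity by `D` carries an eigenvector of `D K D` to one of `D² K = T⁻¹ K`.
    have hw : ((Matrix.diagonal t)⁻¹ * K) *ᵥ (D *ᵥ v) = (1 - μ) • (D *ᵥ v) := by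
      rw [← hDD, Matrix.mulVec_mulVec, ← Matrix.mulVec_smul, ← hv1, Matrix.mulVec_mulVec]
      simp only [Matrix.mul_assoc]
    have hw0 : D *ᵥ v ≠ 0 := by
      intro h0
      apply hv0
      rw [← Matrix.one_mulVec v, ← hED, ← Matrix.mulVec_mulVec, h0, Matrix.mulVec_zero]
    have := abs_le_one_of_realSpectralRadius_le_one h hw0 hw
    have := (abs_le.1 this).2
    show 0 ≤ μ
    linarith
  have := hpsd.conjTranspose_mul_mul_same E
  convert this using 1
  rw [hEt, Matrix.mul_sub, Matrix.sub_mul, Matrix.mul_one, hEE]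
  congr 1
  calc K = (E * D) * K * (D * E) := by rw [hED, hDE]; simp
    _ = _ := by simp only [Matrix.mul_assoc]

open scoped MatrixOrder Matrix.Norms.L2Operator in
/-- A positive semidefinite real quadratic form is nonnegative on tuples of vectors of a complex
inner product space. -/
lemma Matrix.PosSemidef.sum_mul_re_inner_nonneg {n H : Type*} [Fintype n]
    [NormedAddCommGroup H] [InnerProductSpace ℂ H] {A : Matrix n n ℝ} (hA : A.PosSemidef)
    (z : n → H) : 0 ≤ ∑ i, ∑ j, A i j * (inner ℂ (z i) (z j)).re := by
  classical
  obtain ⟨B, hB⟩ := CStarAlgebra.nonneg_iff_eq_star_mul_self.mp hA.nonneg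
  rw [Matrix.star_eq_conjTranspose] at hB
  subst hB
  have : ∑ i, ∑ j, (Bᴴ * B) i j * (inner ℂ (z i) (z j)).re
      = ∑ k, (inner ℂ (∑ i, (B k i : ℂ) • z i) (∑ j, (B k j : ℂ) • z j)).re := by
    simp only [sum_inner, inner_sum, inner_smul_left, inner_smul_right, Complex.re_sum,
      Complex.conj_ofReal, Complex.re_ofReal_mul, Matrix.mul_apply, Matrix.conjTranspose_apply,
      star_trivial, Finset.sum_mul]
    rw [Finset.sum_comm' (t' := Finset.univ) (s' := fun _ => Finset.univ) (by simp)]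
    rw [Finset.sum_comm]
    calc _ = ∑ i, ∑ k, ∑ j, B k i * B k j * (inner ℂ (z i) (z j)).re :=
          Finset.sum_congr rfl fun i _ => Finset.sum_comm
      _ = ∑ k, ∑ i, ∑ j, B k i * B k j * (inner ℂ (z i) (z j)).re := Finset.sum_comm
      _ = _ := Finset.sum_congr rfl fun k _ => by
          rw [Finset.sum_comm]
          simp only [Finset.mul_sum]
          exact Finset.sum_congr rfl fun i _ => Finset.sum_congr rfl fun j _ => by ring
  rw [this]
  exact Finset.sum_nonneg fun k _ => inner_self_nonneg (𝕜 := ℂ)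

lemma sum_mul_re_inner_le_of_realSpectralRadius_le_one {H : Type*}
    [NormedAddCommGroup H] [InnerProductSpace ℂ H] (A : Matrix X Y ℝ) {s : X → ℝ} {t : Y → ℝ}
    (hs : ∀ x, 0 < s x) (ht : ∀ y, 0 < t y)
    (h : realSpectralRadius ((Matrix.diagonal t)⁻¹ * Aᵀ * (Matrix.diagonal s)⁻¹ * A) ≤ 1)
    (u : X → H) (v : Y → H) :
    2 * ∑ x, ∑ y, A x y * (inner ℂ (u x) (v y)).re ≤
      ∑ x, s x * ‖u x‖ ^ 2 + ∑ y, t y * ‖v y‖ ^ 2 := by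
  have hS : (Matrix.diagonal s).PosDef := Matrix.PosDef.diagonal hs
  have hK : (Aᵀ * (Matrix.diagonal s)⁻¹ * A).IsHermitian := by
    rw [inv_diagonal_of_pos hs, Matrix.IsHermitian]
    simp [Matrix.mul_assoc]
  have hL := posSemidef_sub_of_realSpectralRadius_le_one _ hK ht
    (by simpa only [Matrix.mul_assoc] using h)
  have : Invertible (Matrix.diagonal s) := hS.isUnit.invertible
  -- The Schur complement of the first block is `T - Aᵀ S⁻¹ A`, with `S = diagonal s` and `T =
  -- diagonal t`.
  have hB : (Matrix.fromBlocks (Matrix.diagonal s) (-A) (-A)ᴴ (Matrix.diagonal t)).PosSemidef := by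
    rw [Matrix.PosDef.fromBlocks₁₁ _ _ hS]
    simpa using hL
  have hz := hB.sum_mul_re_inner_nonneg (Sum.elim u v)
  have hsymm : ∀ x y, (inner ℂ (v y) (u x)).re = (inner ℂ (u x) (v y)).re :=
    fun x y => inner_re_symm (𝕜 := ℂ) _ _
  have hself : ∀ w : H, (inner ℂ w w).re = ‖w‖ ^ 2 := fun w => by
    rw [inner_self_eq_norm_sq_to_K]; norm_cast
  simp only [Fintype.sum_sum_type, Matrix.fromBlocks_apply₁₁, Matrix.fromBlocks_apply₁₂,
    Matrix.fromBlocks_apply₂₁, Matrix.fromBlocks_apply₂₂, Sum.elim_inl, Sum.elim_inr,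
    Matrix.diagonal_apply, ite_mul, zero_mul, Finset.sum_ite_eq, Finset.mem_univ, if_true,
    Matrix.neg_apply, Matrix.conjTranspose_apply, star_trivial, hsymm, hself,
    Finset.sum_add_distrib, neg_mul, Finset.sum_neg_distrib] at hz
  have hc : ∑ y, ∑ x, A x y * (inner ℂ (u x) (v y)).re
      = ∑ x, ∑ y, A x y * (inner ℂ (u x) (v y)).re := Finset.sum_comm
  linarith

/-- For a complex eigenpair `(μ, v)` put `w = S⁻¹ A v`, `P = w* S w`, `Q = v* T v`. Then `w* A v =
P`, while the eigenvalue equation gives `P = conj μ * Q`. The hypothesis yields `P ≤ Q`, hence `‖μ‖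
≤ 1`. -/
lemma realSpectralRadius_le_one_of_forall (A : Matrix X Y ℝ) {s : X → ℝ} {t : Y → ℝ}
    (hs : ∀ x, 0 < s x) (ht : ∀ y, 0 < t y)
    (h : ∀ (c : X → ℝ) (d : Y → ℝ),
      2 * ∑ x, ∑ y, A x y * (c x * d y) ≤ ∑ x, s x * c x ^ 2 + ∑ y, t y * d y ^ 2) :
    realSpectralRadius ((Matrix.diagonal t)⁻¹ * Aᵀ * (Matrix.diagonal s)⁻¹ * A) ≤ 1 := by
  rw [realSpectralRadius_le_one_iff]
  intro μ v hv0 hv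
  set w : X → ℂ := fun x => (∑ y, A x y * v y) / s x with hw
  have hsC : ∀ x, (s x : ℂ) ≠ 0 := fun x => by exact_mod_cast (hs x).ne'
  have htC : ∀ y, (t y : ℂ) ≠ 0 := fun y => by exact_mod_cast (ht y).ne'
  have hw1 : ∀ x, s x * w x = ∑ y, A x y * v y := fun x =>
    mul_div_cancel₀ _ (hsC x)
  have hw2 : ∀ y, ∑ x, A x y * w x = μ * (t y * v y) := by
    intro y
    have e : ((Matrix.diagonal t)⁻¹ * Aᵀ * (Matrix.diagonal s)⁻¹ * A).map Complex.ofReal *ᵥ v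
        = fun y => (∑ x, A x y * w x) / t y := by
      have hmap : ((Matrix.diagonal t)⁻¹ * Aᵀ * (Matrix.diagonal s)⁻¹ * A).map Complex.ofReal
          = ((Matrix.diagonal t)⁻¹).map Complex.ofReal * Aᵀ.map Complex.ofReal *
            ((Matrix.diagonal s)⁻¹).map Complex.ofReal * A.map Complex.ofReal := by
        change Matrix.map _ Complex.ofRealHom = _
        rw [Matrix.map_mul, Matrix.map_mul, Matrix.map_mul]
        rfl
      rw [hmap, ← Matrix.mulVec_mulVec, ← Matrix.mulVec_mulVec, ← Matrix.mulVec_mulVec,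
        inv_diagonal_of_pos hs, inv_diagonal_of_pos ht]
      rw [Matrix.diagonal_map (by simp), Matrix.diagonal_map (by simp)]
      ext y
      rw [Matrix.mulVec_diagonal]
      simp only [Matrix.mulVec, dotProduct, Matrix.map_apply, Matrix.transpose_apply,
        Matrix.diagonal_apply, ite_mul, zero_mul, Finset.sum_ite_eq, Finset.mem_univ, if_true, hw,
        Complex.ofReal_inv]
      rw [div_eq_inv_mul]
      simp only [div_eq_inv_mul]
    have e2 := congrFun (e.symm.trans hv) y
    simp only [Pi.smul_apply, smul_eq_mul] at e2
    rw [div_eq_iff (htC y)] at e2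
    rw [e2]; ring
  set P : ℝ := ∑ x, s x * Complex.normSq (w x) with hP
  set Q : ℝ := ∑ y, t y * Complex.normSq (v y) with hQ
  have hcross : ∑ x, ∑ y, (A x y : ℂ) * (starRingEnd ℂ (w x) * v y) = P := by
    rw [hP]; push_cast
    refine Finset.sum_congr rfl fun x _ => ?_
    rw [Complex.normSq_eq_conj_mul_self, mul_left_comm, hw1, Finset.mul_sum]
    exact Finset.sum_congr rfl fun y _ => by ring
  have hPQ : (P : ℂ) = starRingEnd ℂ μ * Q := by
    rw [← hcross, Finset.sum_comm, hQ]; push_cast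
    rw [Finset.mul_sum]
    refine Finset.sum_congr rfl fun y _ => ?_
    have := congrArg (starRingEnd ℂ) (hw2 y)
    simp only [map_sum, map_mul, Complex.conj_ofReal] at this
    rw [Complex.normSq_eq_conj_mul_self]
    calc _ = (∑ x, (A x y : ℂ) * starRingEnd ℂ (w x)) * v y := by
          rw [Finset.sum_mul]; exact Finset.sum_congr rfl fun x _ => by ring
      _ = _ := by rw [this]; ring
  have hP0 : 0 ≤ P := Finset.sum_nonneg fun x _ => mul_nonneg (hs x).le (Complex.normSq_nonneg _)
  have hQ0 : 0 < Q := by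
    obtain ⟨y, hy⟩ := Function.ne_iff.1 hv0
    exact Finset.sum_pos' (fun y _ => mul_nonneg (ht y).le (Complex.normSq_nonneg _))
      ⟨y, Finset.mem_univ y, mul_pos (ht y) (Complex.normSq_pos.2 hy)⟩
  -- The real form is applied separately to the real and the imaginary parts of `(w, v)`.
  have hle : 2 * P ≤ P + Q := by
    have h1 := h (fun x => (w x).re) (fun y => (v y).re)
    have h2 := h (fun x => (w x).im) (fun y => (v y).im)
    have h3 : P = ∑ x, ∑ y, A x y * ((w x).re * (v y).re)
        + ∑ x, ∑ y, A x y * ((w x).im * (v y).im) := by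
      have := congrArg Complex.re hcross
      simp only [Complex.re_sum, Complex.mul_re, Complex.conj_re,
        Complex.conj_im, Complex.ofReal_re, Complex.ofReal_im, zero_mul, sub_zero] at this
      rw [← this]
      simp only [← Finset.sum_add_distrib]
      exact Finset.sum_congr rfl fun x _ => Finset.sum_congr rfl fun y _ => by ring
    have h4 : P = ∑ x, s x * (w x).re ^ 2 + ∑ x, s x * (w x).im ^ 2 := by
      rw [hP, ← Finset.sum_add_distrib]
      exact Finset.sum_congr rfl fun x _ => by rw [Complex.normSq_apply]; ring
    have h5 : Q = ∑ y, t y * (v y).re ^ 2 + ∑ y, t y * (v y).im ^ 2 := by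
      rw [hQ, ← Finset.sum_add_distrib]
      exact Finset.sum_congr rfl fun x _ => by rw [Complex.normSq_apply]; ring
    linarith
  have hn := congrArg norm hPQ
  rw [norm_mul, Complex.norm_real, Complex.norm_real, RCLike.norm_conj, Real.norm_of_nonneg hP0,
    Real.norm_of_nonneg hQ0.le] at hn
  by_contra hμ
  push Not at hμ
  nlinarith

end Blocks
-- Operators on the completed tensor product
namespace HilbertTensor

variable {H K : Type*} [NormedAddCommGroup H] [InnerProductSpace ℂ H]
    [NormedAddCommGroup K] [InnerProductSpace ℂ K]

lemma map_coe (S : H →L[ℂ] H) (T : K →L[ℂ] K) (z : H ⊗[ℂ] K) :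
    map S T (z : HilbertTensor H K) = (TensorProduct.mapL S T z : H ⊗[ℂ] K) :=
  ContinuousLinearMap.completion_apply_coe _ _

lemma ext_coe {F G : HilbertTensor H K →L[ℂ] HilbertTensor H K}
    (h : ∀ z : H ⊗[ℂ] K, F z = G z) : F = G := by
  ext z
  induction z using UniformSpace.Completion.induction_on with
  | hp => exact isClosed_eq F.continuous G.continuous
  | ih z => exact h z

lemma map_mul (S S' : H →L[ℂ] H) (T T' : K →L[ℂ] K) :
    map (S * S') (T * T') = map S T * map S' T' :=
  ext_coe fun z => by
    rw [mul_apply_eq_comp, map_coe, map_coe, map_coe, TensorProduct.mapL_mul]; rfl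

lemma map_one_one : map (1 : H →L[ℂ] H) (1 : K →L[ℂ] K) = 1 :=
  ext_coe fun z => by
    rw [map_coe]; exact congrArg _ (congrArg (fun F : _ →L[ℂ] _ => F z) TensorProduct.mapL_id_id)

lemma map_add_left (S S' : H →L[ℂ] H) (T : K →L[ℂ] K) :
    map (S + S') T = map S T + map S' T :=
  ext_coe fun z => by
    rw [add_apply, map_coe, map_coe, map_coe, TensorProduct.mapL_add_left]
    exact UniformSpace.Completion.coe_add _ _

lemma map_add_right (S : H →L[ℂ] H) (T T' : K →L[ℂ] K) :
    map S (T + T') = map S T + map S T' :=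
  ext_coe fun z => by
    rw [add_apply, map_coe, map_coe, map_coe, TensorProduct.mapL_add_right]
    exact UniformSpace.Completion.coe_add _ _

lemma inner_map_left [CompleteSpace H] [CompleteSpace K] {S : H →L[ℂ] H} {T : K →L[ℂ] K}
    (hS : IsSelfAdjoint S) (hT : IsSelfAdjoint T) (z w : HilbertTensor H K) :
    inner ℂ (map S T z) w = inner ℂ z (map S T w) := by
  induction z, w using UniformSpace.Completion.induction_on₂ with
  | hp => exact isClosed_eq (by fun_prop) (by fun_prop)
  | ih z w =>
    rw [map_coe, map_coe, UniformSpace.Completion.inner_coe, UniformSpace.Completion.inner_coe]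
    induction z using TensorProduct.induction_on with
    | zero => simp
    | add z z' hz hz' => rw [_root_.map_add, inner_add_left, hz, hz', inner_add_left]
    | tmul x y =>
      induction w using TensorProduct.induction_on with
      | zero => simp
      | add w w' hw hw' => rw [_root_.map_add, inner_add_right, hw, hw', inner_add_right]
      | tmul x' y' =>
        rw [TensorProduct.mapL_tmul, TensorProduct.mapL_tmul, TensorProduct.inner_tmul,
          TensorProduct.inner_tmul, ← ContinuousLinearMap.adjoint_inner_right,
          ← ContinuousLinearMap.adjoint_inner_right, hS.adjoint_eq, hT.adjoint_eq]

end HilbertTensor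

/-- The `±1`-valued observable of a binary projective measurement. -/
def ProjectiveMeasurement.observable {H : Type*} [NormedAddCommGroup H]
    [InnerProductSpace ℂ H] [CompleteSpace H] (M : ProjectiveMeasurement Bool H) : H →L[ℂ] H :=
  M.proj false - M.proj true

namespace ProjectiveMeasurement

variable {H : Type*} [NormedAddCommGroup H] [InnerProductSpace ℂ H] [CompleteSpace H]
  (M : ProjectiveMeasurement Bool H)

lemma proj_false_add_proj_true : M.proj false + M.proj true = 1 := by
  have := M.sum_eq_one
  rw [Fintype.sum_bool] at this
  rw [← this, add_comm]

lemma isSelfAdjoint_observable : IsSelfAdjoint M.observable :=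
  (M.isStarProjection false).isSelfAdjoint.sub (M.isStarProjection true).isSelfAdjoint

lemma observable_mul_self : M.observable * M.observable = 1 := by
  rw [observable, sub_mul, mul_sub, mul_sub, (M.isStarProjection false).isIdempotentElem.eq,
    (M.isStarProjection true).isIdempotentElem.eq, M.orthogonal _ _ Bool.false_ne_true,
    M.orthogonal _ _ Bool.false_ne_true.symm, ← M.proj_false_add_proj_true]
  abel

end ProjectiveMeasurement

/-! ### Correlators and the vectors of a quantum box -/

lemma bitSign_mul_self (b : Bool) : bitSign b * bitSign b = 1 := by
  cases b <;> simp [bitSign]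

/-- The correlator `E(x, y) = ∑ (-1) ^ (a + b) P(a, b | x, y)`. -/
def Box.correlator {X Y : Type*} (P : Box X Y) (x : X) (y : Y) : ℝ :=
  P false false x y - P false true x y - P true false x y + P true true x y

namespace XORGame

variable {X Y : Type*} [Fintype X] [Fintype Y]

/-- The payoff equals `(1 + (-1)^(a + b + f)) / 2`, so a normalised box matters only through its
correlators. -/
lemma winProb_eq (g : XORGame X Y) (P : Box X Y)
    (hP : ∀ x y, P false false x y + P false true x y + P true false x y + P true true x y = 1) :
    g.winProb P = 1 / 2 + 1 / 2 * ∑ x, ∑ y, g.gameMatrix x y * P.correlator x y := by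
  have h : ∀ x y, ∑ a, ∑ b, g.p x y * g.payoff a b x y * P a b x y =
      1 / 2 * g.p x y + 1 / 2 * (g.gameMatrix x y * P.correlator x y) := by
    intro x y
    have := hP x y
    simp only [Fintype.sum_bool, payoff, gameMatrix, Matrix.of_apply, Box.correlator, bitSign]
    cases g.f x y <;> simp <;> linear_combination (1 / 2 * g.p x y) * this
  rw [winProb]
  simp only [h, Finset.sum_add_distrib, ← Finset.mul_sum, g.p_sum, mul_one]

end XORGame

/-- The correlators of a quantum box are real parts of inner products of unit vectors. -/
lemma Box.IsQuantum.exists_unit_vectors {X Y : Type*} {P : Box X Y} (hP : P.IsQuantum) :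
    (∀ x y, P false false x y + P false true x y + P true false x y + P true true x y = 1) ∧
    ∃ (H : Type) (_ : NormedAddCommGroup H) (_ : InnerProductSpace ℂ H) (u : X → H) (v : Y → H),
      (∀ x, ‖u x‖ = 1) ∧ (∀ y, ‖v y‖ = 1) ∧
      ∀ x y, P.correlator x y = (inner ℂ (u x) (v y)).re := by
  obtain ⟨HA, HB, _, _, _, _, _, _, ψ, M, N, hψ, hP⟩ := hP
  have hψψ : inner ℂ ψ ψ = (1 : ℂ) := by rw [inner_self_eq_norm_sq_to_K, hψ]; simp
  -- Factor `M ⊗ N = (M ⊗ 1)(1 ⊗ N)` and move the self-adjoint first factor to the left of the inner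
  -- product.
  have hP' : ∀ a b x y, P a b x y
      = (inner ℂ (HilbertTensor.map ((M x).proj a) 1 ψ)
          (HilbertTensor.map 1 ((N y).proj b) ψ)).re := by
    intro a b x y
    rw [HilbertTensor.inner_map_left ((M x).isStarProjection a).isSelfAdjoint (.one _),
      ← mul_apply_eq_comp, ← HilbertTensor.map_mul, mul_one, one_mul, ← hP,
      Complex.ofReal_re]
  have hA : ∀ x, HilbertTensor.map ((M x).proj false) (1 : HB →L[ℂ] HB) ψ +
      HilbertTensor.map ((M x).proj true) (1 : HB →L[ℂ] HB) ψ = ψ := fun x => by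
    rw [← add_apply, ← HilbertTensor.map_add_left,
      (M x).proj_false_add_proj_true, HilbertTensor.map_one_one, one_apply_eq_self]
  have hB : ∀ y, HilbertTensor.map (1 : HA →L[ℂ] HA) ((N y).proj false) ψ +
      HilbertTensor.map (1 : HA →L[ℂ] HA) ((N y).proj true) ψ = ψ := fun y => by
    rw [← add_apply, ← HilbertTensor.map_add_right,
      (N y).proj_false_add_proj_true, HilbertTensor.map_one_one, one_apply_eq_self]
  have hA' : ∀ x, HilbertTensor.map (M x).observable (1 : HB →L[ℂ] HB) ψ =
      HilbertTensor.map ((M x).proj false) (1 : HB →L[ℂ] HB) ψ -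
      HilbertTensor.map ((M x).proj true) (1 : HB →L[ℂ] HB) ψ := fun x => by
    rw [eq_sub_iff_add_eq, ← add_apply, ← HilbertTensor.map_add_left,
      ProjectiveMeasurement.observable, sub_add_cancel]
  have hB' : ∀ y, HilbertTensor.map (1 : HA →L[ℂ] HA) (N y).observable ψ =
      HilbertTensor.map (1 : HA →L[ℂ] HA) ((N y).proj false) ψ -
      HilbertTensor.map (1 : HA →L[ℂ] HA) ((N y).proj true) ψ := fun y => by
    rw [eq_sub_iff_add_eq, ← add_apply, ← HilbertTensor.map_add_right,
      ProjectiveMeasurement.observable, sub_add_cancel]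
  have hunit : ∀ z : HilbertTensor HA HB, inner ℂ z z = (1 : ℂ) → ‖z‖ = 1 := fun z hz => by
    have : ‖z‖ ^ 2 = 1 := by rw [← inner_self_eq_norm_sq (𝕜 := ℂ) z, hz]; simp
    exact (pow_eq_one_iff_of_nonneg (norm_nonneg _) two_ne_zero).1 this
  refine ⟨fun x y => ?_, HilbertTensor HA HB, inferInstance, inferInstance,
    fun x => HilbertTensor.map (M x).observable 1 ψ,
    fun y => HilbertTensor.map 1 (N y).observable ψ, fun x => hunit _ ?_, fun y => hunit _ ?_,
    fun x y => ?_⟩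
  · have h1 : (inner ℂ ψ ψ : ℂ).re = 1 := by rw [hψψ]; simp
    have h2 := congrArg₂ (fun z w => (inner ℂ z w : ℂ).re) (hA x) (hB y)
    simp only [h1] at h2
    rw [inner_add_left, inner_add_right, inner_add_right] at h2
    simp only [Complex.add_re, ← hP'] at h2
    linarith
  · rw [HilbertTensor.inner_map_left (M x).isSelfAdjoint_observable (.one _),
      ← mul_apply_eq_comp, ← HilbertTensor.map_mul, (M x).observable_mul_self, one_mul,
      HilbertTensor.map_one_one, one_apply_eq_self, hψψ]
  · rw [HilbertTensor.inner_map_left (.one _) (N y).isSelfAdjoint_observable,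
      ← mul_apply_eq_comp, ← HilbertTensor.map_mul, (N y).observable_mul_self, one_mul,
      HilbertTensor.map_one_one, one_apply_eq_self, hψψ]
  · simp only [hA', hB']
    rw [inner_sub_left, inner_sub_right, inner_sub_right]
    simp only [Complex.sub_re, ← hP', Box.correlator]
    ring

/-! ### Planar qubit strategies -/

section Planar

/-- The projection onto the `(-1) ^ a`-eigenspace of the reflection with angle `θ / 2`. -/
def planarMatrix (θ : ℝ) (a : Bool) : Matrix (Fin 2) (Fin 2) ℂ :=
  !![(1 + bitSign a * Real.cos θ) / 2, bitSign a * Real.sin θ / 2;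
    bitSign a * Real.sin θ / 2, (1 - bitSign a * Real.cos θ) / 2]

lemma ofReal_cos_sq_add_sin_sq (θ : ℝ) : (Real.cos θ : ℂ) ^ 2 + (Real.sin θ : ℂ) ^ 2 = 1 := by
  exact_mod_cast Real.cos_sq_add_sin_sq θ

lemma ofReal_bitSign_mul_self (a : Bool) : (bitSign a : ℂ) * bitSign a = 1 := by
  exact_mod_cast bitSign_mul_self a

lemma planarMatrix_mul_self (θ : ℝ) (a : Bool) :
    planarMatrix θ a * planarMatrix θ a = planarMatrix θ a := by
  have h1 := ofReal_cos_sq_add_sin_sq θ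
  have h2 := ofReal_bitSign_mul_self a
  unfold planarMatrix
  generalize (Real.cos θ : ℂ) = c at *
  generalize (Real.sin θ : ℂ) = s at *
  generalize (bitSign a : ℂ) = r at *
  rw [Matrix.mul_fin_two]
  ext i j
  fin_cases i <;> fin_cases j <;> simp
  · linear_combination (r * r / 4) * h1 + h2 / 4
  · ring
  · ring
  · linear_combination (r * r / 4) * h1 + h2 / 4

lemma planarMatrix_mul_of_ne (θ : ℝ) {a b : Bool} (h : a ≠ b) :
    planarMatrix θ a * planarMatrix θ b = 0 := by
  have h1 := ofReal_cos_sq_add_sin_sq θ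
  have h2 := ofReal_bitSign_mul_self a
  have h3 : (bitSign b : ℂ) = -bitSign a := by
    cases a <;> cases b <;> simp [bitSign] at h ⊢
  unfold planarMatrix
  rw [h3]
  generalize (Real.cos θ : ℂ) = c at *
  generalize (Real.sin θ : ℂ) = s at *
  generalize (bitSign a : ℂ) = r at *
  rw [Matrix.mul_fin_two]
  ext i j
  fin_cases i <;> fin_cases j <;> simp
  · linear_combination (-r * r / 4) * h1 - h2 / 4
  · ring
  · ring
  · linear_combination (-r * r / 4) * h1 - h2 / 4

lemma star_planarMatrix (θ : ℝ) (a : Bool) : star (planarMatrix θ a) = planarMatrix θ a := by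
  ext i j
  fin_cases i <;> fin_cases j <;>
    simp [planarMatrix, Matrix.star_apply,
      -Complex.ofReal_cos, -Complex.ofReal_sin]

lemma sum_planarMatrix (θ : ℝ) : ∑ a, planarMatrix θ a = 1 := by
  rw [Fintype.sum_bool]
  ext i j
  fin_cases i <;> fin_cases j <;> simp [planarMatrix, bitSign] <;> ring

/-- The qubit measurement of the observable `cos θ Z + sin θ X`. -/
def planarMeasurement (θ : ℝ) : ProjectiveMeasurement Bool (EuclideanSpace ℂ (Fin 2)) where
  proj a := Matrix.toEuclideanCLM (n := Fin 2) (𝕜 := ℂ) (planarMatrix θ a)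
  isStarProjection a := by
    constructor
    · rw [IsIdempotentElem, ← _root_.map_mul, planarMatrix_mul_self]
    · rw [IsSelfAdjoint, ← map_star, star_planarMatrix]
  orthogonal a b h := by rw [← _root_.map_mul, planarMatrix_mul_of_ne θ h, map_zero]
  sum_eq_one := by rw [← map_sum, sum_planarMatrix, map_one]

/-- The maximally entangled state of two qubits. -/
def maximallyEntangled :
    HilbertTensor (EuclideanSpace ℂ (Fin 2)) (EuclideanSpace ℂ (Fin 2)) :=
  (∑ i : Fin 2, EuclideanSpace.single i ((√2 : ℝ)⁻¹ : ℂ) ⊗ₜ[ℂ] EuclideanSpace.single i 1 :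
    EuclideanSpace ℂ (Fin 2) ⊗[ℂ] EuclideanSpace ℂ (Fin 2))

/-- The right side is `tr(Aᵀ B) / 2`; for the planar projections it produces `cos (θ - φ)`. -/
lemma inner_maximallyEntangled_map (A B : Matrix (Fin 2) (Fin 2) ℂ) :
    inner ℂ maximallyEntangled (HilbertTensor.map (Matrix.toEuclideanCLM (n := Fin 2) (𝕜 := ℂ) A)
      (Matrix.toEuclideanCLM (n := Fin 2) (𝕜 := ℂ) B) maximallyEntangled) =
      1 / 2 * ∑ i, ∑ j, A i j * B i j := by
  have h2 : ((√2 : ℝ) : ℂ)⁻¹ * ((√2 : ℝ) : ℂ)⁻¹ = 1 / 2 := by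
    rw [← mul_inv, ← Complex.ofReal_mul, Real.mul_self_sqrt zero_le_two]; simp
  rw [maximallyEntangled, HilbertTensor.map_coe, UniformSpace.Completion.inner_coe,
    map_sum, sum_inner, Finset.mul_sum]
  refine Finset.sum_congr rfl fun i _ => ?_
  rw [inner_sum, Finset.mul_sum]
  refine Finset.sum_congr rfl fun j _ => ?_
  rw [TensorProduct.mapL_tmul, TensorProduct.inner_tmul, EuclideanSpace.inner_single_left,
    EuclideanSpace.inner_single_left, ← h2]
  simp [Matrix.ofLp_toEuclideanCLM]
  ring

lemma norm_maximallyEntangled : ‖maximallyEntangled‖ = 1 := by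
  have h := inner_maximallyEntangled_map 1 1
  rw [map_one, HilbertTensor.map_one_one, one_apply_eq_self] at h
  have h' : ‖maximallyEntangled‖ ^ 2 = 1 := by
    rw [← inner_self_eq_norm_sq (𝕜 := ℂ), h]
    simp [Matrix.one_apply]
  exact (pow_eq_one_iff_of_nonneg (norm_nonneg _) two_ne_zero).1 h'

/-- The box obtained by measuring `cos θ Z + sin θ X` on a maximally entangled pair of qubits. -/
def planarBox {X Y : Type*} (θ : X → ℝ) (φ : Y → ℝ) : Box X Y :=
  fun a b x y => (1 + bitSign a * bitSign b * Real.cos (θ x - φ y)) / 4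

lemma isQuantum_planarBox {X Y : Type*} (θ : X → ℝ) (φ : Y → ℝ) : (planarBox θ φ).IsQuantum := by
  refine ⟨EuclideanSpace ℂ (Fin 2), EuclideanSpace ℂ (Fin 2), inferInstance, inferInstance,
    inferInstance, inferInstance, inferInstance, inferInstance, maximallyEntangled,
    fun x => planarMeasurement (θ x), fun y => planarMeasurement (φ y), norm_maximallyEntangled,
    fun a b x y => ?_⟩
  refine Eq.trans ?_ (inner_maximallyEntangled_map _ _).symm
  simp [planarBox, planarMatrix, Fin.sum_univ_two, Real.cos_sub]
  ring

lemma winProb_planarBox {X Y : Type*} [Fintype X] [Fintype Y] (g : XORGame X Y)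
    (θ : X → ℝ) (φ : Y → ℝ) : g.winProb (planarBox θ φ) =
      1 / 2 + 1 / 2 * ∑ x, ∑ y, g.gameMatrix x y * Real.cos (θ x - φ y) := by
  have h : ∀ x y, (planarBox θ φ).correlator x y = Real.cos (θ x - φ y) := fun x y => by
    simp only [Box.correlator, planarBox, bitSign]
    norm_num
    ring
  rw [g.winProb_eq _ fun x y => by simp only [planarBox, bitSign]; norm_num; ring]
  simp only [h]

end Planar

/-! ### From trigonometric inequalities to the quadratic form -/

section QuadraticForm

variable {X Y : Type*} [Fintype X] [Fintype Y]

/-- Divide by `r ^ 2` and let `r → 0`: this extracts the second order condition without Taylor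
expansions. -/
lemma sum_mul_sq_nonneg_of_sum_mul_sin_sq_nonneg {ι : Type*} [Fintype ι] (G k : ι → ℝ)
    (h : ∀ r : ℝ, 0 ≤ ∑ i, G i * Real.sin (r * k i) ^ 2) : 0 ≤ ∑ i, G i * k i ^ 2 := by
  have hd : ∀ i, Filter.Tendsto (fun r : ℝ => r⁻¹ * Real.sin (r * k i))
      (nhdsWithin 0 {0}ᶜ) (nhds (k i)) := fun i => by
    have h1 : HasDerivAt (fun r : ℝ => Real.sin (r * k i)) (k i) 0 := by
      simpa using ((hasDerivAt_id (0 : ℝ)).mul_const (k i)).sin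
    refine (hasDerivAt_iff_tendsto_slope.1 h1).congr fun r => ?_
    simp [slope_def_field, div_eq_inv_mul]
  have ht : Filter.Tendsto (fun r : ℝ => ∑ i, G i * (r⁻¹ * Real.sin (r * k i)) ^ 2)
      (nhdsWithin 0 {0}ᶜ) (nhds (∑ i, G i * k i ^ 2)) :=
    tendsto_finsetSum _ fun i _ => ((hd i).pow 2).const_mul _
  refine ge_of_tendsto' ht fun r => ?_
  have : ∑ i, G i * (r⁻¹ * Real.sin (r * k i)) ^ 2
      = r⁻¹ ^ 2 * ∑ i, G i * Real.sin (r * k i) ^ 2 := by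
    rw [Finset.mul_sum]; exact Finset.sum_congr rfl fun i _ => by ring
  rw [this]
  exact mul_nonneg (sq_nonneg _) (h r)

lemma pos_of_forall_two_mul_sum_le [DecidableEq X] [DecidableEq Y] {A : Matrix X Y ℝ}
    {s : X → ℝ} {t : Y → ℝ}
    (h : ∀ (c : X → ℝ) (d : Y → ℝ),
      2 * ∑ x, ∑ y, A x y * (c x * d y) ≤ ∑ x, s x * c x ^ 2 + ∑ y, t y * d y ^ 2)
    {x : X} {y : Y} (hxy : A x y ≠ 0) : 0 < s x ∧ 0 < t y := by
  have h2 : ∀ a b : ℝ, 2 * (A x y * (a * b)) ≤ s x * a ^ 2 + t y * b ^ 2 := fun a b => by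
    have := h (Pi.single x a) (Pi.single y b)
    simpa [Pi.single_apply, ite_pow, Finset.sum_ite_eq, Finset.sum_ite_eq'] using this
  constructor
  · by_contra hs
    -- This witness makes the cross term `t y + 1`, exceeding the right side, which is at most `t y`
    -- when `s x ≤ 0`.
    have h3 := h2 ((t y + 1) / (2 * A x y)) 1
    have h4 : 2 * (A x y * ((t y + 1) / (2 * A x y) * 1)) = t y + 1 := by field_simp
    nlinarith [sq_nonneg ((t y + 1) / (2 * A x y))]
  · by_contra ht
    have h3 := h2 1 ((s x + 1) / (2 * A x y))
    have h4 : 2 * (A x y * (1 * ((s x + 1) / (2 * A x y)))) = s x + 1 := by field_simp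
    nlinarith [sq_nonneg ((s x + 1) / (2 * A x y))]

end QuadraticForm

/-! ### Comparing the quantum and the classical value -/

namespace XORGame

variable {X Y : Type*} [Fintype X] [Fintype Y] (g : XORGame X Y)

lemma winProb_deterministic (α : X → Bool) (β : Y → Bool) :
    g.winProb (Box.deterministic α β) =
      1 / 2 + 1 / 2 * ∑ x, ∑ y, g.gameMatrix x y * (bitSign (α x) * bitSign (β y)) := by
  rw [g.winProb_eq _ fun x y => by
    simp only [Box.deterministic]; cases α x <;> cases β y <;> simp]
  congr! 6 with x _ y _
  simp only [Box.correlator, Box.deterministic, bitSign]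
  cases α x <;> cases β y <;> simp

/-- The angle of the unit vector `((-1) ^ b, 0)`. -/
def bitAngle (b : Bool) : ℝ := if b then Real.pi else 0

lemma cos_bitAngle_add_sub (a b : Bool) (r s : ℝ) :
    Real.cos (bitAngle a + r - (bitAngle b + s)) =
      bitSign a * bitSign b * Real.cos (r - s) := by
  cases a <;> cases b <;> simp only [bitAngle, bitSign, if_true, Bool.false_eq_true, if_false]
  · simp
  · rw [show 0 + r - (Real.pi + s) = r - s - Real.pi by ring, Real.cos_sub_pi]; ring
  · rw [show Real.pi + r - (0 + s) = r - s + Real.pi by ring, Real.cos_add_pi]; ring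
  · rw [show Real.pi + r - (Real.pi + s) = r - s by ring]; ring

/-- Needed because the real `sSup` is an upper bound only for a bounded set. -/
lemma bddAbove_quantum : BddAbove {w | ∃ P : Box X Y, P.IsQuantum ∧ g.winProb P = w} := by
  refine ⟨1 / 2 + 1 / 2 * ∑ x, ∑ y, |g.gameMatrix x y|, ?_⟩
  rintro _ ⟨P, hP, rfl⟩
  obtain ⟨hsum, H, _, _, u, v, hu, hv, huv⟩ := hP.exists_unit_vectors
  rw [g.winProb_eq P hsum]
  gcongr with x _ y _
  rw [huv]
  have h1 : |(inner ℂ (u x) (v y)).re| ≤ 1 :=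
    (Complex.abs_re_le_norm _).trans ((norm_inner_le_norm _ _).trans_eq (by rw [hu, hv, mul_one]))
  calc _ ≤ |g.gameMatrix x y * (inner ℂ (u x) (v y)).re| := le_abs_self _
    _ ≤ |g.gameMatrix x y| := by
      rw [abs_mul]; exact mul_le_of_le_one_right (abs_nonneg _) h1

lemma winProb_le_quantumValue {P : Box X Y} (hP : P.IsQuantum) :
    g.winProb P ≤ g.quantumValue :=
  le_csSup g.bddAbove_quantum ⟨P, hP, rfl⟩

/-- The planar box with angles `0` and `π` is not deterministic (its marginals are uniform), but it
has the same correlators. -/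
lemma winProb_deterministic_le_quantumValue (α : X → Bool) (β : Y → Bool) :
    g.winProb (Box.deterministic α β) ≤ g.quantumValue := by
  refine le_of_eq_of_le ?_ (g.winProb_le_quantumValue
    (isQuantum_planarBox (fun x => bitAngle (α x) + 0) (fun y => bitAngle (β y) + 0)))
  rw [winProb_planarBox, winProb_deterministic]
  simp only [cos_bitAngle_add_sub, sub_zero, Real.cos_zero, mul_one]

variable {g}

/-- The second order optimality condition of a classical strategy among planar quantum
strategies. -/
lemma IsOptimalClassical.two_mul_sum_le_of_noQuantumAdvantage {α : X → Bool} {β : Y → Bool}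
    (hopt : g.IsOptimalClassical α β) (hno : g.NoQuantumAdvantage) (c : X → ℝ) (d : Y → ℝ) :
    2 * ∑ x, ∑ y, g.gameMatrix x y * (c x * d y) ≤
      ∑ x, (∑ y, g.gameMatrix x y * (bitSign (α x) * bitSign (β y))) * c x ^ 2 +
      ∑ y, (∑ x, g.gameMatrix x y * (bitSign (α x) * bitSign (β y))) * d y ^ 2 := by
  set Φ := g.gameMatrix
  set G : X → Y → ℝ := fun x y => Φ x y * (bitSign (α x) * bitSign (β y)) with hG
  set k : X → Y → ℝ := fun x y => bitSign (α x) * c x - bitSign (β y) * d y with hk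
  have key : 0 ≤ ∑ i : X × Y, G i.1 i.2 * k i.1 i.2 ^ 2 := by
    refine sum_mul_sq_nonneg_of_sum_mul_sin_sq_nonneg _ _ fun r => ?_
    -- The factor 2 makes the loss `1 - cos (2 r k) = 2 sin² (r k)`. The signs turn the cross term
    -- `G * s^A * s^B * c * d` into `Φ * c * d`.
    have h1 := g.winProb_le_quantumValue (isQuantum_planarBox
      (fun x => bitAngle (α x) + 2 * (r * (bitSign (α x) * c x)))
      (fun y => bitAngle (β y) + 2 * (r * (bitSign (β y) * d y))))
    rw [hno, ← hopt, winProb_planarBox, winProb_deterministic] at h1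
    have h2 : ∑ x, ∑ y, G x y * Real.cos (2 * (r * k x y)) ≤ ∑ x, ∑ y, G x y := by
      simp only [cos_bitAngle_add_sub, ← mul_sub] at h1
      simp only [hG, hk, Φ, mul_assoc] at h1 ⊢
      linarith
    rw [Fintype.sum_prod_type]
    have h3 : ∑ x, ∑ y, G x y * Real.sin (r * k x y) ^ 2
        = (∑ x, ∑ y, G x y - ∑ x, ∑ y, G x y * Real.cos (2 * (r * k x y))) / 2 := by
      simp only [← Finset.sum_sub_distrib, Finset.sum_div]
      refine Finset.sum_congr rfl fun x _ => Finset.sum_congr rfl fun y _ => ?_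
      rw [Real.cos_two_mul, Real.cos_sq']; ring
    simp only [h3]
    linarith
  rw [Fintype.sum_prod_type] at key
  have hexp : ∀ x y, G x y * k x y ^ 2
      = G x y * c x ^ 2 + G x y * d y ^ 2 - 2 * (Φ x y * (c x * d y)) := fun x y => by
    have hα := bitSign_mul_self (α x)
    have hβ := bitSign_mul_self (β y)
    simp only [hG, hk]
    generalize bitSign (α x) = a at *
    generalize bitSign (β y) = b at *
    have : a ^ 2 = 1 := by rw [sq, hα]
    have hb : b ^ 2 = 1 := by rw [sq, hβ]
    have e : Φ x y * (a * b) * (a * c x - b * d y) ^ 2 = Φ x y * (a * b) * (a ^ 2 * c x ^ 2)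
      + Φ x y * (a * b) * (b ^ 2 * d y ^ 2) - 2 * (Φ x y * (a ^ 2 * b ^ 2 * (c x * d y))) := by ring
    rw [e, this, hb]; ring
  simp only [hexp, Finset.sum_sub_distrib, Finset.sum_add_distrib, ← Finset.mul_sum] at key
  have hc : ∑ x, ∑ y, G x y * d y ^ 2 = ∑ y, ∑ x, G x y * d y ^ 2 := Finset.sum_comm
  simp only [Finset.sum_mul]
  rw [hc] at key
  simp only [Finset.mul_sum] at key ⊢
  linarith

/-- A bound on the quantum correlations by the diagonal terms of an optimal classical strategy
excludes a quantum advantage. -/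
lemma IsOptimalClassical.noQuantumAdvantage_of_forall {α : X → Bool} {β : Y → Bool}
    (hopt : g.IsOptimalClassical α β)
    (h : ∀ (H : Type) [NormedAddCommGroup H] [InnerProductSpace ℂ H] (u : X → H) (v : Y → H),
      (∀ x, ‖u x‖ = 1) → (∀ y, ‖v y‖ = 1) →
      ∑ x, ∑ y, g.gameMatrix x y * (inner ℂ (u x) (v y)).re ≤
        ∑ x, ∑ y, g.gameMatrix x y * (bitSign (α x) * bitSign (β y))) :
    g.NoQuantumAdvantage := by
  refine le_antisymm ?_ (hopt ▸ g.winProb_deterministic_le_quantumValue α β)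
  refine csSup_le ⟨_, _, isQuantum_planarBox (fun _ => 0) (fun _ => 0), rfl⟩ ?_
  rintro _ ⟨P, hP, rfl⟩
  obtain ⟨hsum, H, _, _, u, v, hu, hv, huv⟩ := hP.exists_unit_vectors
  rw [← hopt, winProb_deterministic, g.winProb_eq P hsum]
  simp only [huv]
  linarith [h H u v hu hv]

/-- Ensures that the fixed vector `s^B` is nonzero. -/
lemma nonempty_right (g : XORGame X Y) : Nonempty Y := by
  by_contra h
  rw [not_nonempty_iff] at h
  have := g.p_sum
  simp at this

end XORGame

/-! ### The eigenvalue 1 and the equivalence -/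

/-- `s^B` is a fixed vector of `Λ⁻¹ Φᵀ Σ⁻¹ Φ`. -/
lemma mulVec_eq_self_of_signs {X Y : Type*} [Fintype X] [Fintype Y] [DecidableEq X]
    [DecidableEq Y] (Φ : Matrix X Y ℝ) {sA : X → ℝ} {sB : Y → ℝ}
    (hA : ∀ x, sA x * sA x = 1) (hB : ∀ y, sB y * sB y = 1)
    (hS : ∀ x, 0 < (Φ *ᵥ sB) x * sA x) (hL : ∀ y, 0 < sB y * (sA ᵥ* Φ) y) :
    ((lambdaMatrix Φ sA sB)⁻¹ * Φᵀ * (sigmaMatrix Φ sA sB)⁻¹ * Φ) *ᵥ sB = sB := by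
  have h1 : (sigmaMatrix Φ sA sB)⁻¹ *ᵥ (Φ *ᵥ sB) = sA := by
    ext x
    rw [sigmaMatrix, inv_diagonal_of_pos hS, Matrix.mulVec_diagonal, inv_mul_eq_iff_eq_mul₀
      (hS x).ne', mul_assoc, hA, mul_one]
  have h2 : (lambdaMatrix Φ sA sB)⁻¹ *ᵥ (Φᵀ *ᵥ sA) = sB := by
    ext y
    rw [lambdaMatrix, inv_diagonal_of_pos hL, Matrix.mulVec_diagonal, inv_mul_eq_iff_eq_mul₀
      (hL y).ne', Matrix.mulVec_transpose, mul_right_comm, hB, one_mul]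
  rw [← Matrix.mulVec_mulVec, ← Matrix.mulVec_mulVec, ← Matrix.mulVec_mulVec, h1, h2]
end

theorem mainTheorem2 {X Y : Type*} [Fintype X] [Fintype Y] [DecidableEq X] [DecidableEq Y]
    (g : XORGame X Y) (Φ : Matrix X Y ℝ) (hΦ : Φ = g.gameMatrix)
    (hrow : ∀ x, ∃ y, Φ x y ≠ 0) (hcol : ∀ y, ∃ x, Φ x y ≠ 0)
    (α : X → Bool) (β : Y → Bool) (hopt : g.IsOptimalClassical α β)
    (sA : X → ℝ) (hsA : ∀ x, sA x = bitSign (α x))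
    (sB : Y → ℝ) (hsB : ∀ y, sB y = bitSign (β y))
    (S : Matrix X X ℝ) (hS : S = sigmaMatrix Φ sA sB)
    (L : Matrix Y Y ℝ) (hL : L = lambdaMatrix Φ sA sB) :
    g.NoQuantumAdvantage ↔
      (S.PosDef ∧ L.PosDef ∧ realSpectralRadius (L⁻¹ * Φᵀ * S⁻¹ * Φ) = 1) := by
  obtain rfl : sA = fun x => bitSign (α x) := funext hsA
  obtain rfl : sB = fun y => bitSign (β y) := funext hsB
  have hs : ∀ x, (Φ *ᵥ fun y => bitSign (β y)) x * bitSign (α x)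
      = ∑ y, Φ x y * (bitSign (α x) * bitSign (β y)) := fun x => by
    rw [Matrix.mulVec, dotProduct, Finset.sum_mul]
    exact Finset.sum_congr rfl fun y _ => by ring
  have ht : ∀ y, bitSign (β y) * ((fun x => bitSign (α x)) ᵥ* Φ) y
      = ∑ x, Φ x y * (bitSign (α x) * bitSign (β y)) := fun y => by
    rw [Matrix.vecMul, dotProduct, Finset.mul_sum]
    exact Finset.sum_congr rfl fun x _ => by ring
  constructor
  · intro hno
    have hq : ∀ (c : X → ℝ) (d : Y → ℝ), 2 * ∑ x, ∑ y, Φ x y * (c x * d y) ≤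
        ∑ x, ((Φ *ᵥ fun y => bitSign (β y)) x * bitSign (α x)) * c x ^ 2 +
        ∑ y, (bitSign (β y) * ((fun x => bitSign (α x)) ᵥ* Φ) y) * d y ^ 2 := by
      simp only [hs, ht]
      rw [hΦ]
      exact hopt.two_mul_sum_le_of_noQuantumAdvantage hno
    have hs0 : ∀ x, 0 < (Φ *ᵥ fun y => bitSign (β y)) x * bitSign (α x) := fun x => by
      obtain ⟨y, hy⟩ := hrow x
      exact (pos_of_forall_two_mul_sum_le hq hy).1
    have ht0 : ∀ y, 0 < bitSign (β y) * ((fun x => bitSign (α x)) ᵥ* Φ) y := fun y => by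
      obtain ⟨x, hx⟩ := hcol y
      exact (pos_of_forall_two_mul_sum_le hq hx).2
    refine ⟨hS ▸ Matrix.PosDef.diagonal hs0, hL ▸ Matrix.PosDef.diagonal ht0,
      le_antisymm ?_ ?_⟩
    · rw [hS, hL]
      exact realSpectralRadius_le_one_of_forall Φ hs0 ht0 hq
    · obtain ⟨y⟩ := g.nonempty_right
      rw [hS, hL]
      refine one_le_realSpectralRadius (v := fun y => bitSign (β y)) (fun h0 => ?_)
        (mulVec_eq_self_of_signs Φ (fun x => bitSign_mul_self _) (fun y => bitSign_mul_self _)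
          hs0 ht0)
      have h1 := bitSign_mul_self (β y)
      rw [show bitSign (β y) = 0 from congrFun h0 y] at h1
      simp at h1
  · rintro ⟨hSp, hLp, hρ⟩
    rw [hS, sigmaMatrix, Matrix.posDef_diagonal_iff] at hSp
    rw [hL, lambdaMatrix, Matrix.posDef_diagonal_iff] at hLp
    rw [hS, hL] at hρ
    refine hopt.noQuantumAdvantage_of_forall fun H _ _ u v hu hv => ?_
    have h1 := sum_mul_re_inner_le_of_realSpectralRadius_le_one Φ hSp hLp hρ.le u v
    simp only [hu, hv, one_pow, mul_one, hs, ht] at h1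
    -- On unit vectors the diagonal terms become `tr Σ + tr Λ`; both traces equal the classical
    -- bias.
    rw [Finset.sum_comm (s := (Finset.univ : Finset Y))] at h1
    rw [← hΦ]
    linarith
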